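/- For a finite group $G$ let $\mathcal{N}(G)$ be the lattice of normal subgroups of $G$, ordered by inclusion, and let $\operatorname{Aut}(\mathcal{N}(G))$ be the group of its lattice automorphisms, i.e. of the bijections $\varphi$ of $\mathcal{N}(G)$ with $H \le K \Leftrightarrow \varphi(H) \le \varphi(K)$. The LatAut tower of $G_0$ is defined by $G_{n+1} = \operatorname{Aut}(\mathcal{N}(G_n))$ for $n \ge 0$. Call $G$ a tower group if $G \cong \prod_{k \ge 3} S_k^{a_k}$ for some integers $a_k \ge 0$ of which only finitely many are nonzero. Theorem (Termination). For every tower group $G_0$, the LatAut tower satisfies $G_3 = 1$. This bound is sharp: for the tower group $G_0 = S_4^2 \times S_3^2$ one has $G_1 \cong C_2^2$, $G_2 \cong S_3 \neq 1$ and $G_3 = 1$. -/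

import Mathlib

/-- The lattice `𝒩(G)` of normal subgroups of `G`, ordered by inclusion. -/
abbrev NormalLattice (G : Type*) [Group G] : Type _ :=
  {N : Subgroup G // N.Normal}

/-- `LatAut(G) = Aut(𝒩(G))`: the bijections `φ` of the set of normal subgroups with
`H ≤ K ↔ φ H ≤ φ K`. It is a group under composition. -/
abbrev LatAut (G : Type*) [Group G] : Type _ :=
  NormalLattice G ≃o NormalLattice G

/-- The LatAut tower `G₀ = G`, `Gₙ₊₁ = Aut(𝒩(Gₙ))`, as a sequence of (bundled) groups. -/
def latAutTower (G : Type*) [Group G] : ℕ → GrpCat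
  | 0 => GrpCat.of G
  | n + 1 => GrpCat.of (LatAut (latAutTower G n))

/-- `G` is a tower group: `G ≅ ∏_{k ≥ 3} S_k ^ (a_k)` with finitely many nonzero `a_k`. -/
def IsTowerGroup (G : Type*) [Group G] : Prop :=
  ∃ a : {k : ℕ // 3 ≤ k} →₀ ℕ,
    Nonempty (G ≃* ((k : {k : ℕ // 3 ≤ k}) → Fin (a k) → Equiv.Perm (Fin (k : ℕ))))

/-- The cyclic group `C_2`, written multiplicatively. -/
abbrev CyclicTwo : Type := Multiplicative (ZMod 2)

/-- The group `S_4² × S_3²`. -/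
abbrev SharpExample : Type :=
  (Fin 2 → Equiv.Perm (Fin 4)) × (Fin 2 → Equiv.Perm (Fin 3))

/-!
The proof determines `𝒩(G)` for a finite product `G = ∏ i, S_{k i}` with all `k i ≥ 3`. A normal
subgroup `N` of `G` contains the commutators of its elements with each factor, and for the symmetric
groups the subgroup of these commutators contains every even element of the projection of `N` to the
factor (`IsSignGroup`, `isSignGroup_perm`). So `N` is determined by the group `W` of sign vectors of
its elements and by the family `c`, where `c i` is the even part of its `i`-th projection; the only
constraint is that `c i` is the whole alternating group whenever some vector of `W` is `-1` at `i`
(`SignData`, `normalLatticeOrderIso`). The subgroups that can occur as `c i` form a chain: `1 < A_k`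
for `k ≠ 4`, and `1 < V < A_4` for `k = 4`.

The atoms of this lattice correspond to the factors. An automorphism that fixes all atoms is
trivial (`SignData.indexPerm_injective`): it fixes the data concentrated at a single factor, since
these form a finite chain, so it preserves `c`, hence the supports of the sign vectors, and a vector
with two possible values in each coordinate is determined by its support. A permutation of the atoms
extends to the lattice if and only if it matches factors whose chains have the same length. Hence
`Aut(𝒩(G))` is `S_a × S_b`, where `a` is the number of factors of degree `4` and `b` that of the
others (`nonempty_latAut_pi_perm_mulEquiv`).

In the next step `Aut(𝒩(S_a × S_b))` is trivial if `a ≤ 1` or `b ≤ 1`, because the normal subgroups of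
a symmetric group form a chain. If `a, b ≥ 3`, the result above bounds its order by two. If one of
`a, b` is `2` and the other is at least `3`, then all normal subgroups are fixed except the two
graphs over the larger factor (`card_latAut_prod_le_two`). If `a = b = 2`, it is the group `S_3` of all
permutations of the three subgroups of order two. In each case the normal subgroups of the result
form a chain (`normalChain_latAut_perm_prod_perm`), so the third group of the tower is trivial. The
group `S_4² × S_3²` has `a = b = 2`.
-/

/-! ### Automorphisms of finite posets -/

/-- An automorphism of a finite poset fixes pointwise every chain that it preserves. -/
theorem OrderIso.apply_eq_self_of_mem_chain {L : Type*} [PartialOrder L] [Finite L]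
    (φ : L ≃o L) (S : Set L) (hS : ∀ x ∈ S, ∀ y ∈ S, x ≤ y ∨ y ≤ x)
    (hφ : ∀ x, x ∈ S ↔ φ x ∈ S) {x : L} (hx : x ∈ S) : φ x = x := by
  classical
  let _ : LinearOrder S :=
    { (inferInstance : PartialOrder S) with
      le_total := fun a b => hS a a.2 b b.2
      toDecidableLE := Classical.decRel _ }
  let e : S ≃o S := ⟨φ.toEquiv.subtypeEquiv hφ, φ.map_rel_iff⟩
  exact congrArg (fun f : S ≃o S => ((f ⟨x, hx⟩ : S) : L))
    (Subsingleton.elim e (OrderIso.refl S))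

theorem nonempty_orderIso_of_card_eq {P Q : Type*} [PartialOrder P] [PartialOrder Q]
    [Finite P] [Finite Q] (hP : ∀ x y : P, x ≤ y ∨ y ≤ x) (hQ : ∀ x y : Q, x ≤ y ∨ y ≤ x)
    (h : Nat.card P = Nat.card Q) : Nonempty (P ≃o Q) := by
  classical
  let _ : LinearOrder P :=
    { (inferInstance : PartialOrder P) with
      le_total := hP
      toDecidableLE := Classical.decRel _ }
  let _ : LinearOrder Q :=
    { (inferInstance : PartialOrder Q) with
      le_total := hQ
      toDecidableLE := Classical.decRel _ }
  have := Fintype.ofFinite P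
  have := Fintype.ofFinite Q
  exact ⟨(Fintype.orderIsoFinOfCardEq P (Nat.card_eq_fintype_card (α := P)).symm).symm.trans
    (Fintype.orderIsoFinOfCardEq Q (by rw [h, Nat.card_eq_fintype_card]))⟩

theorem subsingleton_orderIso_of_total {L : Type*} [PartialOrder L] [Finite L]
    (h : ∀ x y : L, x ≤ y ∨ y ≤ x) : Subsingleton (L ≃o L) := by
  refine ⟨fun f g => OrderIso.ext (funext fun x => ?_)⟩
  rw [f.apply_eq_self_of_mem_chain Set.univ (fun x _ y _ => h x y) (by simp) (Set.mem_univ x),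
    g.apply_eq_self_of_mem_chain Set.univ (fun x _ y _ => h x y) (by simp) (Set.mem_univ x)]

/-- Conjugation by an order isomorphism, as an isomorphism of automorphism groups. -/
def OrderIso.conjMulEquiv {L M : Type*} [PartialOrder L] [PartialOrder M] (e : L ≃o M) :
    (L ≃o L) ≃* (M ≃o M) where
  toFun φ := (e.symm.trans φ).trans e
  invFun ψ := (e.trans ψ).trans e.symm
  left_inv φ := by ext; simp
  right_inv ψ := by ext; simp
  map_mul' φ ψ := by
    ext x
    simp only [OrderIso.trans_apply, RelIso.mul_apply, OrderIso.symm_apply_apply]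

/-- The action of the automorphisms of a poset on its atoms. -/
def OrderIso.atomPerm (L : Type*) [PartialOrder L] [OrderBot L] :
    (L ≃o L) →* Equiv.Perm {a : L // IsAtom a} where
  toFun φ := φ.toEquiv.subtypeEquiv fun a => (φ.isAtom_iff a).symm
  map_one' := rfl
  map_mul' _ _ := rfl

@[simp]
theorem OrderIso.atomPerm_apply {L : Type*} [PartialOrder L] [OrderBot L] (φ : L ≃o L)
    (a : {a : L // IsAtom a}) : ((OrderIso.atomPerm L φ a : {a : L // IsAtom a}) : L) = φ a := rfl

/-- In a lattice of length two every permutation of the atoms extends uniquely to an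
automorphism. -/
theorem OrderIso.atomPerm_bijective {L : Type*} [PartialOrder L] [BoundedOrder L]
    (htop : ¬ IsAtom (⊤ : L)) (h : ∀ x : L, x = ⊥ ∨ x = ⊤ ∨ IsAtom x) :
    Function.Bijective (OrderIso.atomPerm L) := by
  classical
  constructor
  · intro φ ψ hφψ
    refine OrderIso.ext (funext fun x => ?_)
    rcases h x with rfl | rfl | hx
    · simp
    · simp
    · simpa using congrArg Subtype.val (Equiv.congr_fun hφψ ⟨x, hx⟩)
  · intro σ
    have hbot : ¬ IsAtom (⊥ : L) := fun h => h.1 rfl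
    let f : Equiv.Perm {a : L // IsAtom a} → L → L := fun σ x =>
      if hx : IsAtom x then (σ ⟨x, hx⟩ : L) else x
    have f_atom (σ) (a : {a : L // IsAtom a}) : f σ a = σ a := dif_pos a.2
    have f_bot (σ) : f σ ⊥ = ⊥ := dif_neg hbot
    have f_top (σ) : f σ ⊤ = ⊤ := dif_neg htop
    have f_inv (σ τ : Equiv.Perm {a : L // IsAtom a}) (hστ : ∀ a, τ (σ a) = a) (x : L) :
        f τ (f σ x) = x := by
      rcases h x with rfl | rfl | hx
      · rw [f_bot, f_bot]
      · rw [f_top, f_top]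
      · rw [f_atom σ ⟨x, hx⟩, f_atom, hστ]
    have f_mono (σ) : Monotone (f σ) := by
      intro x y hxy
      rcases h x with rfl | rfl | hx
      · rw [f_bot]; exact bot_le
      · rw [top_le_iff.1 hxy]
      · rcases h y with rfl | rfl | hy
        · rw [le_bot_iff.1 hxy]
        · rw [f_top]; exact le_top
        · rcases hy.le_iff.1 hxy with rfl | rfl
          · exact absurd hx hbot
          · exact le_rfl
    refine ⟨⟨⟨f σ, f σ.symm, f_inv _ _ σ.symm_apply_apply, f_inv _ _ σ.apply_symm_apply⟩, ?_⟩, ?_⟩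
    · intro x y
      refine ⟨fun hxy => ?_, fun hxy => f_mono σ hxy⟩
      simpa [f_inv σ σ.symm σ.symm_apply_apply] using f_mono σ.symm hxy
    · ext a
      exact f_atom σ a

/-! ### The lattice of sign data -/

section SignData

variable {ι : Type*} {C : ι → Type*} [∀ i, PartialOrder (C i)] [∀ i, BoundedOrder (C i)]

/-- The model for the lattice of normal subgroups of a product of symmetric groups: pairs of a
group `W` of sign vectors and a family `c` with `c i` in the chain `C i`, such that `c i` is the top
of its chain as soon as the `i`-th coordinate is not constantly `1` on `W`. The order is
componentwise. -/
abbrev SignData (C : ι → Type*) [∀ i, PartialOrder (C i)] [∀ i, BoundedOrder (C i)] : Type _ :=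
  {p : Subgroup (ι → ℤˣ) × (∀ i, C i) // ∀ w ∈ p.1, ∀ i, w i ≠ 1 → p.2 i = ⊤}

namespace SignData

/-- The datum with trivial sign group and chain part `c`. -/
def ofChain (c : ∀ i, C i) : SignData C :=
  ⟨(⊥, c), fun w hw i hi => absurd (by rw [Subgroup.mem_bot.1 hw]; rfl) hi⟩

theorem ofChain_le_iff {c : ∀ i, C i} {x : SignData C} : ofChain c ≤ x ↔ c ≤ x.1.2 :=
  ⟨fun h => h.2, fun h => ⟨bot_le, h⟩⟩

instance : OrderBot (SignData C) where
  bot := ofChain ⊥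
  bot_le _ := ofChain_le_iff.2 bot_le

/-- A sign vector is determined by its support. -/
theorem sign_ext {v w : ι → ℤˣ} (h : ∀ i, v i ≠ 1 ↔ w i ≠ 1) : v = w := by
  funext i
  have := h i
  rcases Int.units_eq_one_or (v i) with hv | hv <;> rcases Int.units_eq_one_or (w i) with hw | hw <;>
    simp_all

theorem mem_zpowers_sign {v w : ι → ℤˣ} (h : v ∈ Subgroup.zpowers w) : v = 1 ∨ v = w := by
  obtain ⟨n, rfl⟩ := h
  have hw : w ^ (2 : ℤ) = 1 := by
    funext i
    rcases Int.units_eq_one_or (w i) with hw | hw <;> simp [hw]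
  rcases Int.even_or_odd' n with ⟨k, rfl | rfl⟩
  · left
    simp only [zpow_mul, hw, one_zpow]
  · right
    simp only [zpow_add, zpow_mul, hw, one_zpow, zpow_one, one_mul]

open Classical in
/-- The smallest datum whose sign group contains `w`. -/
noncomputable def line (w : ι → ℤˣ) : SignData C :=
  ⟨(Subgroup.zpowers w, fun i => if w i ≠ 1 then ⊤ else ⊥), by
    intro v hv i hi
    rcases mem_zpowers_sign hv with rfl | rfl
    · exact absurd rfl hi
    · exact if_pos hi⟩

theorem line_snd_of_ne {w : ι → ℤˣ} {i : ι} (h : w i ≠ 1) : (line w : SignData C).1.2 i = ⊤ :=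
  if_pos h

theorem line_snd_of_eq {w : ι → ℤˣ} {i : ι} (h : w i = 1) : (line w : SignData C).1.2 i = ⊥ :=
  if_neg (not_not.2 h)

theorem line_le_iff {w : ι → ℤˣ} {x : SignData C} : line w ≤ x ↔ w ∈ x.1.1 := by
  refine ⟨fun h => h.1 (Subgroup.mem_zpowers w), fun h => ⟨?_, fun i => ?_⟩⟩
  · exact (Subgroup.zpowers_le).2 h
  · by_cases hi : w i = 1
    · rw [line_snd_of_eq hi]; exact bot_le
    · rw [x.2 w h i hi]; exact le_top

open Classical in
/-- The datum with trivial sign group whose chain part is concentrated at `i`, with value `c`. -/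
noncomputable def single (i : ι) (c : C i) : SignData C := ofChain (Function.update ⊥ i c)

theorem single_le_iff {i : ι} {c : C i} {x : SignData C} : single i c ≤ x ↔ c ≤ x.1.2 i := by
  classical
  rw [single, ofChain_le_iff, update_le_iff]
  simp

theorem single_snd_same (i : ι) (c : C i) : (single i c : SignData C).1.2 i = c := by
  simp [single, ofChain]

theorem single_snd_of_ne {i j : ι} (h : j ≠ i) (c : C i) : (single i c : SignData C).1.2 j = ⊥ := by
  simp [single, ofChain, h]

/-- An automorphism that fixes all data `single i c` is trivial. The chain part of a datum, and
with it the support of a sign vector, is preserved; over the two-element group of signs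
the support determines the vector. -/
theorem eq_one_of_forall_single [Finite ι] [∀ i, Nontrivial (C i)] (φ : SignData C ≃o SignData C)
    (h : ∀ i c, φ (single i c) = single i c) : φ = 1 := by
  classical
  have hsnd (x) : (φ x).1.2 = x.1.2 := by
    funext i
    apply le_antisymm
    · rw [← single_le_iff, ← φ.le_iff_le, h, single_le_iff]
    · rw [← single_le_iff, ← h, φ.le_iff_le, single_le_iff]
  have hofChain (c) : φ (ofChain c) = ofChain c := by
    apply le_antisymm
    · rw [← φ.le_symm_apply, ofChain_le_iff, ← hsnd, φ.apply_symm_apply]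
      rfl
    · rw [ofChain_le_iff, hsnd]
      rfl
  have hline (n : ℕ) : ∀ w : ι → ℤˣ, Set.ncard {i | w i ≠ 1} = n → φ (line w) = line w := by
    induction n using Nat.strong_induction_on with
    | _ n ih =>
      intro w hw
      -- Vectors of smaller support are already fixed, so they cannot lie in the image.
      have key : ∀ v ∈ (φ (line w)).1.1, v ≠ 1 → v = w := by
        intro v hv hv1
        have hsub : {i | v i ≠ 1} ⊆ {i | w i ≠ 1} := by
          intro i hi hwi
          have := (φ (line w)).2 v hv i hi
          rw [hsnd, line_snd_of_eq hwi] at this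
          exact bot_ne_top this
        by_cases heq : {i | v i ≠ 1} = {i | w i ≠ 1}
        · exact sign_ext fun i => Set.ext_iff.1 heq i
        · have hlt : Set.ncard {i | v i ≠ 1} < n :=
            hw ▸ Set.ncard_lt_ncard (hsub.ssubset_of_ne heq) (Set.toFinite _)
          have hle : line v ≤ φ (line w) := line_le_iff.2 hv
          rw [← ih _ hlt v rfl, φ.le_iff_le, line_le_iff] at hle
          exact (mem_zpowers_sign hle).resolve_left hv1
      have hne : w ≠ 1 → (φ (line w)).1.1 ≠ ⊥ := by
        intro hw1 hbot
        have h1 : φ (line w) = ofChain (line w : SignData C).1.2 :=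
          Subtype.ext (Prod.ext hbot (hsnd _))
        have h2 := congrArg (fun x : SignData C => x.1.1) (φ.injective (h1.trans (hofChain _).symm))
        exact hw1 (Subgroup.zpowers_eq_bot.1 h2)
      refine Subtype.ext (Prod.ext (le_antisymm ?_ ?_) (hsnd _))
      · intro v hv
        by_cases hv1 : v = 1
        · rw [hv1]; exact one_mem _
        · rw [key v hv hv1]; exact Subgroup.mem_zpowers w
      · by_cases hw1 : w = 1
        · rw [hw1]
          exact (Subgroup.zpowers_eq_bot.2 rfl).trans_le bot_le
        · obtain ⟨v, hv, hv1⟩ := (Subgroup.bot_or_exists_ne_one _).resolve_left (hne hw1)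
          exact Subgroup.zpowers_le.2 (key v hv hv1 ▸ hv)
  refine OrderIso.ext (funext fun x => Subtype.ext (Prod.ext (Subgroup.ext fun w => ?_) (hsnd x)))
  change w ∈ (φ x).1.1 ↔ w ∈ x.1.1
  rw [← line_le_iff, ← line_le_iff, ← hline _ w rfl, φ.le_iff_le, hline _ w rfl]

/-! ### Atoms of the lattice of sign data -/

theorem exists_snd_ne_bot [∀ i, Nontrivial (C i)] {x : SignData C} (hx : x ≠ ⊥) :
    ∃ i, x.1.2 i ≠ ⊥ := by
  by_contra! hcon
  refine hx (Subtype.ext (Prod.ext ((Subgroup.eq_bot_iff_forall _).2 fun w hw => ?_)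
    (funext fun i => hcon i)))
  funext i
  by_contra hi
  exact bot_ne_top ((hcon i).symm.trans (x.2 w hw i hi))

theorem single_eq_bot_iff {i : ι} {c : C i} : (single i c : SignData C) = ⊥ ↔ c = ⊥ := by
  rw [← le_bot_iff, single_le_iff]
  exact le_bot_iff

theorem isAtom_single {i : ι} {c : C i} (hc : IsAtom c) : IsAtom (single i c : SignData C) := by
  refine ⟨mt single_eq_bot_iff.1 hc.1, fun x hx => ?_⟩
  have hle := hx.le
  have hfst : x.1.1 = ⊥ := le_bot_iff.1 hle.1
  have hj (j) (hj : j ≠ i) : x.1.2 j = ⊥ :=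
    le_bot_iff.1 ((hle.2 j).trans_eq (single_snd_of_ne hj c))
  have hi : x.1.2 i ≤ c := (hle.2 i).trans_eq (single_snd_same i c)
  rcases hc.le_iff.1 hi with h | h
  · refine Subtype.ext (Prod.ext hfst (funext fun j => ?_))
    by_cases hji : j = i
    · subst hji; exact h
    · exact hj j hji
  · exact absurd (single_le_iff.2 h.ge) hx.not_ge

variable [∀ i, Finite (C i)] [∀ i, Nontrivial (C i)]

theorem exists_isAtom (i : ι) : ∃ a : C i, IsAtom a :=
  let ⟨a, ha, _⟩ := (eq_bot_or_exists_atom_le (⊤ : C i)).resolve_left top_ne_bot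
  ⟨a, ha⟩

/-- The smallest nonzero element of the chain `C i`. -/
noncomputable def minElt (i : ι) : C i := (exists_isAtom i).choose

theorem isAtom_minElt (i : ι) : IsAtom (minElt i : C i) := (exists_isAtom i).choose_spec

/-- The atom of the lattice of sign data at the index `i`. -/
noncomputable def atom (C : ι → Type*) [∀ i, PartialOrder (C i)] [∀ i, BoundedOrder (C i)]
    [∀ i, Finite (C i)] [∀ i, Nontrivial (C i)] (i : ι) : SignData C :=
  single i (minElt i)

theorem isAtom_atom (i : ι) : IsAtom (atom C i) := isAtom_single (isAtom_minElt i)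

variable (htot : ∀ i, ∀ x y : C i, x ≤ y ∨ y ≤ x)
include htot

theorem atom_le_iff {i : ι} {x : SignData C} : atom C i ≤ x ↔ x.1.2 i ≠ ⊥ := by
  rw [atom, single_le_iff]
  refine ⟨fun h h' => (isAtom_minElt i).1 (le_bot_iff.1 (h.trans_eq h')), fun h => ?_⟩
  rcases htot i (minElt i) (x.1.2 i) with h' | h'
  · exact h'
  · exact (((isAtom_minElt i).le_iff.1 h').resolve_left h).ge

theorem isAtom_iff {a : SignData C} : IsAtom a ↔ ∃ i, atom C i = a := by
  refine ⟨fun ha => ?_, ?_⟩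
  · obtain ⟨i, hi⟩ := exists_snd_ne_bot ha.1
    exact ⟨i, (ha.le_iff.1 ((atom_le_iff htot).2 hi)).resolve_left (isAtom_atom i).1⟩
  · rintro ⟨i, rfl⟩
    exact isAtom_atom i

theorem atom_injective : Function.Injective (atom C) := by
  intro i j hij
  by_contra hne
  have h := hij.le
  rw [atom_le_iff htot] at h
  exact h (single_snd_of_ne hne _)

/-- The atoms of the lattice of sign data correspond to the indices. -/
noncomputable def atomEquiv : ι ≃ {a : SignData C // IsAtom a} :=
  Equiv.ofBijective (fun i => ⟨atom C i, isAtom_atom i⟩)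
    ⟨fun _ _ h => atom_injective htot (congrArg Subtype.val h), fun a =>
      let ⟨i, hi⟩ := (isAtom_iff htot).1 a.2
      ⟨i, Subtype.ext hi⟩⟩

/-- The action of the automorphisms of the lattice of sign data on the indices, through
the atoms. -/
noncomputable def indexPerm : (SignData C ≃o SignData C) →* Equiv.Perm ι :=
  (atomEquiv htot).symm.permCongrHom.toMonoidHom.comp (OrderIso.atomPerm (SignData C))

theorem atom_indexPerm (φ : SignData C ≃o SignData C) (i : ι) :
    atom C (indexPerm htot φ i) = φ (atom C i) :=
  congrArg Subtype.val ((atomEquiv htot).apply_symm_apply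
    (OrderIso.atomPerm (SignData C) φ (atomEquiv htot i)))

theorem snd_eq_bot_iff (φ : SignData C ≃o SignData C) (i : ι) (x : SignData C) :
    (φ x).1.2 (indexPerm htot φ i) = ⊥ ↔ x.1.2 i = ⊥ := by
  rw [← not_iff_not, ← ne_eq, ← ne_eq, ← atom_le_iff htot, ← atom_le_iff htot, atom_indexPerm,
    φ.le_iff_le]

/-- The data whose chain part is concentrated at the index `i`. -/
def supportedAt (C : ι → Type*) [∀ i, PartialOrder (C i)] [∀ i, BoundedOrder (C i)] (i : ι) :
    Set (SignData C) :=
  {x | ∀ j, j ≠ i → x.1.2 j = ⊥}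

theorem mem_supportedAt_iff (φ : SignData C ≃o SignData C) (i : ι) (x : SignData C) :
    x ∈ supportedAt C i ↔ φ x ∈ supportedAt C (indexPerm htot φ i) := by
  refine ⟨fun h j hj => ?_, fun h j hj => ?_⟩
  · obtain ⟨k, rfl⟩ := (indexPerm htot φ).surjective j
    exact (snd_eq_bot_iff htot φ k x).2 (h k fun hk => hj (hk ▸ rfl))
  · exact (snd_eq_bot_iff htot φ j x).1 (h _ fun hk => hj ((indexPerm htot φ).injective hk))

omit htot [∀ i, Finite (C i)] in
/-- The only nontrivial sign vector of a datum concentrated at `i` is the one that is `-1`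
exactly at `i`. -/
theorem eq_of_mem_supportedAt {i : ι} {x y : SignData C} (hx : x ∈ supportedAt C i)
    (hy : y ∈ supportedAt C i) {v w : ι → ℤˣ} (hv : v ∈ x.1.1) (hw : w ∈ y.1.1) (hv1 : v ≠ 1)
    (hw1 : w ≠ 1) : v = w := by
  have key {x : SignData C} (hx : x ∈ supportedAt C i) {v : ι → ℤˣ} (hv : v ∈ x.1.1)
      (hv1 : v ≠ 1) (j : ι) : v j ≠ 1 ↔ j = i := by
    have h1 (j) (hj : v j ≠ 1) : j = i := by
      by_contra hji
      exact bot_ne_top ((hx j hji).symm.trans (x.2 v hv j hj))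
    refine ⟨h1 j, ?_⟩
    rintro rfl hj
    exact hv1 (funext fun k => by_contra fun hk => hk (h1 k hk ▸ hj))
  exact sign_ext fun j => (key hx hv hv1 j).trans (key hy hw hw1 j).symm

omit [∀ i, Finite (C i)] in
theorem supportedAt_total {i : ι} {x y : SignData C} (hx : x ∈ supportedAt C i)
    (hy : y ∈ supportedAt C i) : x ≤ y ∨ y ≤ x := by
  have key {x y : SignData C} (hx : x ∈ supportedAt C i) (h : x.1.2 i ≤ y.1.2 i) :
      x.1.2 ≤ y.1.2 := by
    intro j
    by_cases hj : j = i
    · subst hj; exact h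
    · rw [hx j hj]; exact bot_le
  -- A datum concentrated at `i` with nontrivial sign group is the largest one.
  have hmax {x y : SignData C} (hx : x ∈ supportedAt C i) (hy : y ∈ supportedAt C i)
      (h : x.1.1 ≠ ⊥) : y ≤ x := by
    obtain ⟨v, hv, hv1⟩ := (Subgroup.bot_or_exists_ne_one _).resolve_left h
    have hvi : v i ≠ 1 := fun hvi => hv1 <| funext fun j => by
      by_contra hj
      have := x.2 v hv j hj
      by_cases hji : j = i
      · exact hj (hji ▸ hvi)
      · exact bot_ne_top ((hx j hji).symm.trans this)
    refine ⟨fun w hw => ?_, key hy ((x.2 v hv i hvi) ▸ le_top)⟩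
    by_cases hw1 : w = 1
    · exact hw1 ▸ one_mem _
    · exact eq_of_mem_supportedAt hy hx hw hv hw1 hv1 ▸ hv
  by_cases hx1 : x.1.1 = ⊥
  · by_cases hy1 : y.1.1 = ⊥
    · exact (htot i (x.1.2 i) (y.1.2 i)).imp
        (fun h => ⟨hx1.le.trans bot_le, key hx h⟩) (fun h => ⟨hy1.le.trans bot_le, key hy h⟩)
    · exact Or.inl (hmax hy hx hy1)
  · exact Or.inr (hmax hx hy hx1)

/-- An automorphism that fixes the atoms preserves each of the chains `supportedAt C i`, hence
fixes all data `single i c`. -/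
theorem indexPerm_injective [Finite ι] : Function.Injective (indexPerm (C := C) htot) := by
  rw [injective_iff_map_eq_one]
  intro φ hφ
  refine eq_one_of_forall_single φ fun i c => ?_
  refine φ.apply_eq_self_of_mem_chain (supportedAt C i)
    (fun x hx y hy => supportedAt_total htot hx hy) (fun x => ?_) fun j hj =>
      single_snd_of_ne hj c
  simpa [hφ] using mem_supportedAt_iff htot φ i x

omit htot in
/-- The length of the chain `C i` can be read off from the lattice of sign data: besides the data
`single i c` there is exactly one datum concentrated at `i`. -/
theorem card_supportedAt (i : ι) : Nat.card (supportedAt C i) = Nat.card (C i) + 1 := by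
  classical
  rw [← Finite.card_option]
  have hw (j : ι) : Pi.mulSingle (M := fun _ => ℤˣ) i (-1) j ≠ 1 ↔ j = i := by
    by_cases hj : j = i
    · subst hj; simp
    · simp [hj]
  have hline : (line (Pi.mulSingle i (-1)) : SignData C) ∈ supportedAt C i := fun j hj =>
    line_snd_of_eq (not_not.1 (mt (hw j).1 hj))
  have hne : Pi.mulSingle (M := fun _ => ℤˣ) i (-1) ≠ 1 := fun h =>
    (hw i).2 rfl (congrFun h i)
  symm
  refine Nat.card_congr (Equiv.ofBijective (fun o => o.elim ⟨line (Pi.mulSingle i (-1)), hline⟩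
    fun c => ⟨single i c, fun j hj => single_snd_of_ne hj c⟩) ⟨?_, ?_⟩)
  · have hls (c : C i) : (line (Pi.mulSingle i (-1)) : SignData C) ≠ single i c := fun h =>
      hne (Subgroup.zpowers_eq_bot.1 (congrArg (fun x : SignData C => x.1.1) h))
    rintro (_ | c) (_ | d) h
    · rfl
    · exact absurd (congrArg Subtype.val h) (hls d)
    · exact absurd (congrArg Subtype.val h).symm (hls c)
    · have := congrArg (fun x : SignData C => x.1.2 i) (congrArg Subtype.val h)
      exact congrArg some (by simpa [single_snd_same] using this)
  · rintro ⟨x, hx⟩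
    by_cases hx1 : x.1.1 = ⊥
    · refine ⟨some (x.1.2 i), Subtype.ext (Subtype.ext (Prod.ext hx1.symm (funext fun j => ?_)))⟩
      by_cases hj : j = i
      · subst hj; exact single_snd_same _ _
      · exact (single_snd_of_ne hj _).trans (hx j hj).symm
    · obtain ⟨v, hv, hv1⟩ := (Subgroup.bot_or_exists_ne_one _).resolve_left hx1
      have hv' : v = Pi.mulSingle i (-1) :=
        eq_of_mem_supportedAt hx hline hv (Subgroup.mem_zpowers _) hv1 hne
      subst hv'
      refine ⟨none, Subtype.ext (le_antisymm (line_le_iff.2 hv) ⟨fun w hw => ?_, fun j => ?_⟩)⟩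
      · by_cases hw1 : w = 1
        · exact hw1 ▸ one_mem _
        · exact eq_of_mem_supportedAt hx hx hw hv hw1 hv1 ▸ Subgroup.mem_zpowers _
      · by_cases hj : j = i
        · exact le_top.trans_eq (line_snd_of_ne ((hw j).2 hj)).symm
        · exact (hx j hj).trans_le bot_le

omit htot [∀ i, Finite (C i)] [∀ i, Nontrivial (C i)] in
/-- A permutation of the indices together with isomorphisms of the chains it matches induces an
automorphism of the lattice of sign data. -/
theorem exists_permute (σ : Equiv.Perm ι) (e : ∀ i, C i ≃o C (σ i)) :
    ∃ φ : SignData C ≃o SignData C, ∀ x i, (φ x).1.2 (σ i) = e i (x.1.2 i) := by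
  let f : Subgroup (ι → ℤˣ) ≃o Subgroup (ι → ℤˣ) :=
    (MulEquiv.arrowCongr σ (MulEquiv.refl ℤˣ)).mapSubgroup
  let g : (∀ i, C i) ≃ (∀ i, C i) := σ.piCongr fun i => (e i).toEquiv
  have hg (c : ∀ i, C i) (i : ι) : g c (σ i) = e i (c i) :=
    Equiv.piCongr_apply_apply σ (fun i => (e i).toEquiv) c i
  have hgle (c d : ∀ i, C i) : g c ≤ g d ↔ c ≤ d := by
    refine ⟨fun h i => ?_, fun h i => ?_⟩
    · have := h (σ i)
      rwa [hg, hg, (e i).le_iff_le] at this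
    · obtain ⟨j, rfl⟩ := σ.surjective i
      rw [hg, hg, (e j).le_iff_le]
      exact h j
  have hp (p : Subgroup (ι → ℤˣ) × (∀ i, C i)) : (∀ w ∈ p.1, ∀ i, w i ≠ 1 → p.2 i = ⊤) ↔
      ∀ w ∈ (f.toEquiv.prodCongr g p).1, ∀ i, w i ≠ 1 → (f.toEquiv.prodCongr g p).2 i = ⊤ := by
    refine ⟨fun h w hw i hi => ?_, fun h w hw i hi => ?_⟩
    · obtain ⟨v, hv, rfl⟩ := hw
      obtain ⟨j, rfl⟩ := σ.surjective i
      change g p.2 (σ j) = ⊤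
      rw [hg, h v hv j, map_top]
      simpa [MulEquiv.arrowCongr] using hi
    · have := h _ (Subgroup.mem_map_of_mem _ hw) (σ i) (by simpa [MulEquiv.arrowCongr] using hi)
      change g p.2 (σ i) = ⊤ at this
      rwa [hg, map_eq_top_iff] at this
  exact ⟨⟨(f.toEquiv.prodCongr g).subtypeEquiv hp,
    fun {x y} => and_congr (f.le_iff_le) (hgle x.1.2 y.1.2)⟩, fun x i => hg x.1.2 i⟩

/-- The permutations of the indices that come from automorphisms are those that preserve the
lengths of the chains. -/
theorem mem_range_indexPerm_iff [Finite ι] {σ : Equiv.Perm ι} :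
    σ ∈ (indexPerm (C := C) htot).range ↔ ∀ i, Nat.card (C (σ i)) = Nat.card (C i) := by
  constructor
  · rintro ⟨φ, rfl⟩ i
    have h := Nat.card_congr (φ.toEquiv.subtypeEquiv (mem_supportedAt_iff htot φ i))
    have h1 := card_supportedAt (C := C) i
    have h2 := card_supportedAt (C := C) (indexPerm htot φ i)
    rw [Set.coe_eq_subtype] at h1 h2
    lia
  · intro h
    have e (i : ι) : C i ≃o C (σ i) :=
      (nonempty_orderIso_of_card_eq (htot i) (htot (σ i)) (h i).symm).some
    obtain ⟨φ, hφ⟩ := exists_permute σ e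
    refine ⟨φ, Equiv.ext fun i => ?_⟩
    by_contra hne
    have h1 : atom C (indexPerm htot φ i) ≤ φ (atom C i) := (atom_indexPerm htot φ i).le
    rw [atom_le_iff htot] at h1
    obtain ⟨j, hj⟩ := σ.surjective (indexPerm htot φ i)
    rw [← hj] at h1 hne
    rw [hφ, ne_eq, map_eq_bot_iff] at h1
    exact h1 (single_snd_of_ne (fun hji => hne (congrArg σ hji)) _)

/-- If the chains have two isomorphism types, distinguished by `p`, the automorphism
group of the lattice of sign data is the product of the two symmetric groups on the indices of
either type. -/
theorem nonempty_mulEquiv_perm_prod_perm [Finite ι] (p : ι → Prop)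
    (hp : ∀ i j, Nat.card (C i) = Nat.card (C j) ↔ (p i ↔ p j)) :
    Nonempty ((SignData C ≃o SignData C) ≃*
      Equiv.Perm {i // p i} × Equiv.Perm {i // ¬ p i}) := by
  classical
  have hrange : (indexPerm (C := C) htot).range = (Equiv.Perm.subtypeCongrHom p).range := by
    ext σ
    rw [mem_range_indexPerm_iff]
    simp only [hp]
    constructor
    · intro h
      refine ⟨(σ.subtypePerm h, σ.subtypePerm fun i => not_congr (h i)), Equiv.ext fun i => ?_⟩
      by_cases hi : p i <;> simp [hi]
    · rintro ⟨τ, rfl⟩ i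
      by_cases hi : p i
      · simp [hi, Subtype.prop]
      · simp [hi, (τ.2 ⟨i, hi⟩).2]
  exact ⟨(MonoidHom.ofInjective (indexPerm_injective htot)).trans <|
    (MulEquiv.subgroupCongr hrange).trans
      (MonoidHom.ofInjective (Equiv.Perm.subtypeCongrHom_injective p)).symm⟩

end SignData

end SignData

/-! ### Normal subgroups of products of groups with a sign -/

/-- The properties of the symmetric groups, with the sign, that determine the normal
subgroups of their products: `s` is onto, every proper normal subgroup is contained in its kernel,
and commutators with the whole group recover the even part of a normal subgroup. -/
structure IsSignGroup {H : Type*} [Group H] (s : H →* ℤˣ) : Prop where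
  surjective : Function.Surjective s
  eq_top_or_le (N : Subgroup H) : N.Normal → N = ⊤ ∨ N ≤ s.ker
  inf_le_commutator (N : Subgroup H) : N.Normal → N ⊓ s.ker ≤ ⁅N, ⊤⁆

/-- The normal subgroups of a group that consist of elements of sign `1`. -/
abbrev EvenNormal {H : Type*} [Group H] (s : H →* ℤˣ) : Type _ :=
  {K : Subgroup H // K.Normal ∧ K ≤ s.ker}

instance {H : Type*} [Group H] (s : H →* ℤˣ) : BoundedOrder (EvenNormal s) where
  top := ⟨s.ker, inferInstance, le_rfl⟩
  le_top K := K.2.2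
  bot := ⟨⊥, inferInstance, bot_le⟩
  bot_le K := (bot_le : (⊥ : Subgroup H) ≤ K.1)

section Product

variable {ι : Type*} {H : ι → Type*} [∀ i, Group (H i)] (s : ∀ i, H i →* ℤˣ)

/-- The vector of the signs of the coordinates. -/
def signVector : (∀ i, H i) →* (ι → ℤˣ) := MonoidHom.pi fun i => (s i).comp (Pi.evalMonoidHom H i)

@[simp]
theorem signVector_apply (g : ∀ i, H i) (i : ι) : signVector s g i = s i (g i) := rfl

/-- The sign data of a normal subgroup of a product: the group of its sign vectors, and the
even parts of its projections to the factors. -/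
def signDataOfNormal (hs : ∀ i, IsSignGroup (s i)) (N : NormalLattice (∀ i, H i)) :
    SignData fun i => EvenNormal (s i) :=
  ⟨(N.1.map (signVector s), fun i => ⟨N.1.map (Pi.evalMonoidHom H i) ⊓ (s i).ker, by
      have := N.2.map (Pi.evalMonoidHom H i) (Function.surjective_eval i)
      infer_instance, inf_le_right⟩), by
    rintro _ ⟨n, hn, rfl⟩ i hi
    refine Subtype.ext (inf_eq_right.2 ?_)
    have h := (hs i).eq_top_or_le _ (N.2.map (Pi.evalMonoidHom H i) (Function.surjective_eval i))
    rcases h with h | h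
    · rw [h]; exact le_top
    · exact absurd (h ⟨n, hn, rfl⟩) hi⟩

/-- The normal subgroup with given sign data. -/
def normalOfSignData (x : SignData fun i => EvenNormal (s i)) : NormalLattice (∀ i, H i) :=
  ⟨{ carrier := {g | signVector s g ∈ x.1.1 ∧ ∀ i, g i ∈ (x.1.2 i).1 ∨ x.1.2 i = ⊤}
     one_mem' := ⟨by rw [map_one]; exact one_mem _, fun i => Or.inl (one_mem _)⟩
     mul_mem' := fun {a b} ha hb => ⟨by rw [map_mul]; exact mul_mem ha.1 hb.1, fun i =>
       (ha.2 i).elim (fun h => (hb.2 i).imp_left fun h' => mul_mem h h') Or.inr⟩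
     inv_mem' := fun {a} ha => ⟨by rw [map_inv]; exact inv_mem ha.1, fun i =>
       (ha.2 i).imp_left fun h => inv_mem h⟩ }, by
    refine ⟨fun n hn g => ⟨?_, fun i => (hn.2 i).imp_left fun h => (x.1.2 i).2.1.conj_mem _ h _⟩⟩
    rw [map_mul, map_mul, map_inv, mul_inv_cancel_comm]
    exact hn.1⟩

theorem normalOfSignData_mono : Monotone (normalOfSignData s) := by
  intro x y h g hg
  refine ⟨h.1 hg.1, fun i => (hg.2 i).imp (fun hgi => h.2 i hgi) fun hi => ?_⟩
  exact top_le_iff.1 (hi ▸ h.2 i)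

theorem signDataOfNormal_mono (hs : ∀ i, IsSignGroup (s i)) : Monotone (signDataOfNormal s hs) :=
  fun _ _ h => ⟨Subgroup.map_mono h, fun _ => inf_le_inf_right _ (Subgroup.map_mono h)⟩

open scoped commutatorElement in
/-- A normal subgroup of a product contains the even part of each of its projections, because it
contains the commutators of its elements with the factors. -/
theorem mulSingle_mem_of_mem_map_inf_ker [DecidableEq ι] (hs : ∀ i, IsSignGroup (s i))
    {N : Subgroup (∀ i, H i)} (hN : N.Normal) {i : ι} {h : H i}
    (hh : h ∈ N.map (Pi.evalMonoidHom H i) ⊓ (s i).ker) : Pi.mulSingle i h ∈ N := by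
  have hN' := hN.map (Pi.evalMonoidHom H i) (Function.surjective_eval i)
  suffices hle : ⁅N.map (Pi.evalMonoidHom H i), ⊤⁆ ≤ N.comap (MonoidHom.mulSingle H i) from
    hle ((hs i).inf_le_commutator _ hN' hh)
  rw [Subgroup.commutator_le]
  rintro _ ⟨n, hn, rfl⟩ k -
  have heq : MonoidHom.mulSingle H i ⁅Pi.evalMonoidHom H i n, k⁆ = ⁅n, Pi.mulSingle i k⁆ := by
    funext j
    by_cases hj : j = i
    · subst hj
      simp [commutatorElement_def]
    · simp [commutatorElement_def, hj]
  rw [Subgroup.mem_comap, heq, commutatorElement_def, mul_assoc, mul_assoc, ← mul_assoc _ n⁻¹]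
  exact mul_mem hn (hN.conj_mem _ (inv_mem hn) _)

theorem normalOfSignData_signDataOfNormal [Finite ι] (hs : ∀ i, IsSignGroup (s i))
    (N : NormalLattice (∀ i, H i)) : normalOfSignData s (signDataOfNormal s hs N) = N := by
  classical
  refine Subtype.ext (Subgroup.ext fun g => ⟨?_, fun hg => ⟨⟨g, hg, rfl⟩, fun i => ?_⟩⟩)
  · rintro ⟨⟨n, hn, hng⟩, hg⟩
    have hsign (i : ι) : s i (n i) = s i (g i) := congrFun hng i
    suffices hmem : g * n⁻¹ ∈ N.1 by simpa using mul_mem hmem hn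
    refine Subgroup.pi_mem_of_mulSingle_mem _ fun i => ?_
    refine mulSingle_mem_of_mem_map_inf_ker s hs N.2 ?_
    have hker : (g * n⁻¹) i ∈ (s i).ker := by
      simp [MonoidHom.mem_ker, hsign]
    rcases hg i with h | h
    · refine ⟨?_, hker⟩
      exact mul_mem h.1 ((N.1.map (Pi.evalMonoidHom H i)).inv_mem ⟨n, hn, rfl⟩)
    · exact (congrArg Subtype.val h).ge hker
  · have hN' := N.2.map (Pi.evalMonoidHom H i) (Function.surjective_eval i)
    rcases (hs i).eq_top_or_le _ hN' with h | h
    · refine Or.inr (Subtype.ext ?_)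
      change _ ⊓ _ = (s i).ker
      rw [h, top_inf_eq]
    · exact Or.inl ⟨⟨g, hg, rfl⟩, h ⟨g, hg, rfl⟩⟩

theorem signDataOfNormal_normalOfSignData (hs : ∀ i, IsSignGroup (s i))
    (x : SignData fun i => EvenNormal (s i)) :
    signDataOfNormal s hs (normalOfSignData s x) = x := by
  classical
  refine Subtype.ext (Prod.ext (Subgroup.ext fun w => ⟨?_, fun hw => ?_⟩)
    (funext fun i => Subtype.ext (Subgroup.ext fun h => ⟨?_, fun hh => ?_⟩)))
  · rintro ⟨g, hg, rfl⟩
    exact hg.1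
  · choose g hg using fun i => (hs i).surjective (w i)
    have hgw : signVector s (fun i => if w i = 1 then 1 else g i) = w := by
      funext i
      by_cases hi : w i = 1 <;> simp [hi, hg]
    refine ⟨_, ⟨by rwa [hgw], fun i => ?_⟩, hgw⟩
    by_cases hi : w i = 1
    · left
      simp only [hi, if_true]
      exact one_mem _
    · exact Or.inr (x.2 w hw i hi)
  · rintro ⟨⟨g, hg, rfl⟩, hker⟩
    rcases hg.2 i with h | h
    · exact h
    · exact (congrArg Subtype.val h).ge hker
  · have hker := (x.1.2 i).2.2 hh
    refine ⟨⟨Pi.mulSingle i h, ⟨?_, fun j => ?_⟩, Pi.mulSingle_eq_same i h⟩, hker⟩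
    · have : signVector s (Pi.mulSingle i h) = 1 := by
        funext j
        by_cases hj : j = i
        · subst hj
          simpa using hker
        · simp [hj]
      rw [this]
      exact one_mem _
    · by_cases hj : j = i
      · subst hj
        left
        rwa [Pi.mulSingle_eq_same]
      · left
        rw [Pi.mulSingle_eq_of_ne hj]
        exact one_mem _

/-- The lattice of normal subgroups of a product of groups with a sign. -/
def normalLatticeOrderIso [Finite ι] (hs : ∀ i, IsSignGroup (s i)) :
    NormalLattice (∀ i, H i) ≃o SignData fun i => EvenNormal (s i) where
  toFun := signDataOfNormal s hs
  invFun := normalOfSignData s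
  left_inv := normalOfSignData_signDataOfNormal s hs
  right_inv := signDataOfNormal_normalOfSignData s hs
  map_rel_iff' {N M} := by
    refine ⟨fun h => ?_, fun h => signDataOfNormal_mono s hs h⟩
    rw [← normalOfSignData_signDataOfNormal s hs N, ← normalOfSignData_signDataOfNormal s hs M]
    exact normalOfSignData_mono s h

end Product

/-! ### Normal subgroups of the symmetric groups -/

theorem alternatingGroup_le_of_isThreeCycle_mem {α : Type*} [Fintype α] [DecidableEq α]
    {N : Subgroup (Equiv.Perm α)} (hN : N.Normal) {σ : Equiv.Perm α} (hσ : σ.IsThreeCycle)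
    (hmem : σ ∈ N) : alternatingGroup α ≤ N := by
  rw [← Equiv.Perm.closure_three_cycles_eq_alternating, Subgroup.closure_le]
  intro τ hτ
  obtain ⟨ρ, rfl⟩ := isConj_iff.1 (Equiv.Perm.isConj_iff_cycleType_eq.2 (hσ.trans hτ.symm))
  exact hN.conj_mem _ hmem _

theorem eq_alternatingGroup_or_eq_top {α : Type*} [Fintype α] [DecidableEq α]
    {N : Subgroup (Equiv.Perm α)} (hN : alternatingGroup α ≤ N) :
    N = alternatingGroup α ∨ N = ⊤ := by
  by_cases h : N ≤ alternatingGroup α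
  · exact Or.inl (le_antisymm h hN)
  · obtain ⟨σ, hσ, hσA⟩ := SetLike.not_le_iff_exists.1 h
    refine Or.inr ((Subgroup.eq_top_iff' _).2 fun τ => ?_)
    by_cases hτ : τ ∈ alternatingGroup α
    · exact hN hτ
    · have hmem : τ * σ⁻¹ ∈ alternatingGroup α := by
        rw [Equiv.Perm.mem_alternatingGroup] at hσA hτ ⊢
        have h1 := (Int.units_eq_one_or _).resolve_left hσA
        have h2 := (Int.units_eq_one_or _).resolve_left hτ
        simp [h1, h2]
      simpa using mul_mem (hN hmem) hσ

open scoped commutatorElement in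
/-- A nontrivial normal subgroup is not central: the symmetric group has trivial center. -/
theorem commutator_top_ne_bot {n : ℕ} (hn : 3 ≤ n) {N : Subgroup (Equiv.Perm (Fin n))}
    (hN : N ≠ ⊥) : ⁅N, (⊤ : Subgroup (Equiv.Perm (Fin n)))⁆ ≠ ⊥ := by
  obtain ⟨σ, hσ, hσ1⟩ := (Subgroup.bot_or_exists_ne_one _).resolve_left hN
  obtain ⟨i, hi⟩ : ∃ i, σ i ≠ i := by
    by_contra! h
    exact hσ1 (Equiv.ext h)
  obtain ⟨l, hl⟩ := Finset.exists_mem_notMem_of_card_lt_card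
    (s := {i, σ i}) (t := Finset.univ) (by
      rw [Finset.card_univ, Fintype.card_fin]
      exact Finset.card_le_two.trans_lt hn)
  simp only [Finset.mem_insert, Finset.mem_singleton, not_or] at hl
  intro hbot
  have h1 : ⁅σ, Equiv.swap (σ i) l⁆ ∈ (⊥ : Subgroup (Equiv.Perm (Fin n))) :=
    hbot ▸ Subgroup.commutator_mem_commutator hσ (Subgroup.mem_top _)
  rw [Subgroup.mem_bot, commutatorElement_eq_one_iff_mul_comm] at h1
  have h2 := Equiv.congr_fun h1 i
  rw [Equiv.Perm.mul_apply, Equiv.Perm.mul_apply, Equiv.swap_apply_left,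
    Equiv.swap_apply_of_ne_of_ne hi.symm (fun h => hl.2.1 h.symm)] at h2
  exact hl.2.2 h2.symm

/-- The normal Klein four-group of the symmetric group of degree `4`. -/
def kleinFourPerm : Subgroup (Equiv.Perm (Fin 4)) where
  carrier := {σ | σ * σ = 1 ∧ (σ = 1 ∨ ∀ i, σ i ≠ i)}
  one_mem' := by simp
  mul_mem' := by
    simp only [Set.mem_ofPred_eq]
    decide +kernel
  inv_mem' := by
    simp only [Set.mem_ofPred_eq]
    decide +kernel

theorem mem_kleinFourPerm {σ : Equiv.Perm (Fin 4)} :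
    σ ∈ kleinFourPerm ↔ σ * σ = 1 ∧ (σ = 1 ∨ ∀ i, σ i ≠ i) := Iff.rfl

/-- Every nontrivial permutation of three letters has a 3-cycle among its commutators. -/
theorem isThreeCycle_commutator_three :
    ∀ σ : Equiv.Perm (Fin 3), σ ≠ 1 → ∃ τ, (σ * τ * σ⁻¹ * τ⁻¹).support.card = 3 := by
  decide +kernel

/-- Every permutation of four letters outside the normal Klein four-group has a 3-cycle among its
commutators. Membership in `kleinFourPerm` is spelled out to make the statement decidable. -/
theorem isThreeCycle_commutator_four :
    ∀ σ : Equiv.Perm (Fin 4), ¬ (σ * σ = 1 ∧ (σ = 1 ∨ ∀ i, σ i ≠ i)) →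
      ∃ τ, (σ * τ * σ⁻¹ * τ⁻¹).support.card = 3 := by
  decide +kernel

theorem exists_conj_kleinFourPerm :
    ∀ σ : Equiv.Perm (Fin 4), (σ * σ = 1 ∧ (σ = 1 ∨ ∀ i, σ i ≠ i)) → σ ≠ 1 →
      ∀ τ : Equiv.Perm (Fin 4), (τ * τ = 1 ∧ (τ = 1 ∨ ∀ i, τ i ≠ i)) → τ ≠ 1 →
        ∃ ρ, ρ * σ * ρ⁻¹ = τ := by
  decide +kernel

theorem kleinFourPerm_le_alternatingGroup : kleinFourPerm ≤ alternatingGroup (Fin 4) := by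
  have : ∀ σ : Equiv.Perm (Fin 4), (σ * σ = 1 ∧ (σ = 1 ∨ ∀ i, σ i ≠ i)) →
      Equiv.Perm.sign σ = 1 := by
    decide +kernel
  exact fun σ hσ => Equiv.Perm.mem_alternatingGroup.2 (this σ hσ)

theorem alternatingGroup_le_commutator_of_notMem_kleinFourPerm {N : Subgroup (Equiv.Perm (Fin 4))}
    (hN : N.Normal) {σ : Equiv.Perm (Fin 4)} (hσ : σ ∈ N) (hσV : σ ∉ kleinFourPerm) :
    alternatingGroup (Fin 4) ≤ ⁅N, (⊤ : Subgroup (Equiv.Perm (Fin 4)))⁆ := by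
  obtain ⟨τ, hτ⟩ := isThreeCycle_commutator_four σ (mt mem_kleinFourPerm.2 hσV)
  exact alternatingGroup_le_of_isThreeCycle_mem inferInstance (card_support_eq_three_iff.1 hτ)
    (Subgroup.commutator_mem_commutator hσ (Subgroup.mem_top τ))

theorem alternatingGroup_not_le_kleinFourPerm : ¬ alternatingGroup (Fin 4) ≤ kleinFourPerm := by
  have h : ∃ σ : Equiv.Perm (Fin 4), Equiv.Perm.sign σ = 1 ∧
      ¬ (σ * σ = 1 ∧ (σ = 1 ∨ ∀ i, σ i ≠ i)) := by
    decide +kernel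
  obtain ⟨σ, hσ, hσV⟩ := h
  exact fun hle => hσV (hle (Equiv.Perm.mem_alternatingGroup.2 hσ))

theorem kleinFourPerm_ne_bot : kleinFourPerm ≠ ⊥ := by
  have h : ∃ σ : Equiv.Perm (Fin 4), (σ * σ = 1 ∧ (σ = 1 ∨ ∀ i, σ i ≠ i)) ∧ σ ≠ 1 := by
    decide +kernel
  obtain ⟨σ, hσ, hσ1⟩ := h
  exact fun hbot => hσ1 (Subgroup.mem_bot.1 (hbot ▸ hσ))

theorem normal_kleinFourPerm : kleinFourPerm.Normal := by
  refine ⟨fun σ hσ τ => ⟨?_, hσ.2.imp (fun h => by simp [h]) fun h i hi => ?_⟩⟩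
  · rw [show τ * σ * τ⁻¹ * (τ * σ * τ⁻¹) = τ * (σ * σ) * τ⁻¹ by group, hσ.1]
    simp
  · refine h (τ⁻¹ i) (τ.injective ?_)
    simpa using hi

theorem normal_perm_four {N : Subgroup (Equiv.Perm (Fin 4))} (hN : N.Normal) :
    N = ⊥ ∨ N = kleinFourPerm ∨ alternatingGroup (Fin 4) ≤ N := by
  by_cases hle : N ≤ kleinFourPerm
  · refine or_iff_not_imp_left.2 fun hbot => Or.inl (le_antisymm hle fun τ hτ => ?_)
    obtain ⟨σ, hσ, hσ1⟩ := (Subgroup.bot_or_exists_ne_one _).resolve_left hbot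
    by_cases hτ1 : τ = 1
    · exact hτ1 ▸ one_mem _
    · obtain ⟨ρ, rfl⟩ := exists_conj_kleinFourPerm σ (hle hσ) hσ1 τ hτ hτ1
      exact hN.conj_mem _ hσ _
  · obtain ⟨σ, hσ, hσV⟩ := SetLike.not_le_iff_exists.1 hle
    exact Or.inr (Or.inr ((alternatingGroup_le_commutator_of_notMem_kleinFourPerm hN hσ hσV).trans
      (Subgroup.commutator_le_left _ _)))

theorem normal_perm {n : ℕ} (hn : 3 ≤ n) (hn4 : n ≠ 4) {N : Subgroup (Equiv.Perm (Fin n))}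
    (hN : N.Normal) : N = ⊥ ∨ alternatingGroup (Fin n) ≤ N := by
  refine or_iff_not_imp_left.2 fun hbot => ?_
  rcases hn.eq_or_lt with rfl | hn
  · obtain ⟨σ, hσ, hσ1⟩ := (Subgroup.bot_or_exists_ne_one _).resolve_left hbot
    obtain ⟨τ, hτ⟩ := isThreeCycle_commutator_three σ hσ1
    exact alternatingGroup_le_of_isThreeCycle_mem hN (card_support_eq_three_iff.1 hτ)
      (Subgroup.commutator_le_left N ⊤
        (Subgroup.commutator_mem_commutator hσ (Subgroup.mem_top τ)))
  · exact Equiv.Perm.alternatingGroup_le_of_normal (by rw [Nat.card_fin]; lia)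
      ((Subgroup.nontrivial_iff_ne_bot _).2 hbot)

theorem isSignGroup_perm {n : ℕ} (hn : 3 ≤ n) :
    IsSignGroup (Equiv.Perm.sign : Equiv.Perm (Fin n) →* ℤˣ) := by
  have : Nontrivial (Fin n) := Fin.nontrivial_iff_two_le.2 (by lia)
  have hA {N : Subgroup (Equiv.Perm (Fin n))} (h : alternatingGroup (Fin n) ≤ N) :
      N = ⊤ ∨ N ≤ alternatingGroup (Fin n) :=
    (eq_alternatingGroup_or_eq_top h).symm.imp_right le_of_eq
  refine ⟨Equiv.Perm.sign_surjective (Fin n), fun N hN => ?_, fun N hN => ?_⟩ <;>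
    rw [← alternatingGroup_eq_sign_ker]
  · by_cases hn4 : n = 4
    · subst hn4
      rcases normal_perm_four hN with rfl | rfl | h
      · exact Or.inr bot_le
      · exact Or.inr kleinFourPerm_le_alternatingGroup
      · exact hA h
    · rcases normal_perm hn hn4 hN with rfl | h
      · exact Or.inr bot_le
      · exact hA h
  · by_cases hbot : N = ⊥
    · rw [hbot]
      exact inf_le_left.trans bot_le
    have hK := commutator_top_ne_bot hn hbot
    by_cases hn4 : n = 4
    · subst hn4
      by_cases hle : N ≤ kleinFourPerm
      · rcases normal_perm_four
          (inferInstance : ⁅N, (⊤ : Subgroup (Equiv.Perm (Fin 4)))⁆.Normal) with h | h | h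
        · exact absurd h hK
        · exact inf_le_left.trans (hle.trans h.ge)
        · exact inf_le_right.trans h
      · obtain ⟨σ, hσ, hσV⟩ := SetLike.not_le_iff_exists.1 hle
        exact inf_le_right.trans (alternatingGroup_le_commutator_of_notMem_kleinFourPerm hN hσ hσV)
    · exact inf_le_right.trans ((normal_perm hn hn4 inferInstance).resolve_left hK)

theorem normal_perm_total {n : ℕ} (hn : 3 ≤ n) (N M : NormalLattice (Equiv.Perm (Fin n))) :
    N ≤ M ∨ M ≤ N := by
  obtain ⟨N, hN⟩ := N
  obtain ⟨M, hM⟩ := M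
  simp only [Subtype.mk_le_mk]
  have hA {N M : Subgroup (Equiv.Perm (Fin n))} (h : alternatingGroup (Fin n) ≤ N)
      (h' : alternatingGroup (Fin n) ≤ M) : N ≤ M ∨ M ≤ N := by
    rcases eq_alternatingGroup_or_eq_top h with rfl | rfl
    · exact Or.inl h'
    · exact Or.inr le_top
  by_cases hn4 : n = 4
  · subst hn4
    rcases normal_perm_four hN with rfl | rfl | h
    · exact Or.inl bot_le
    · rcases normal_perm_four hM with rfl | rfl | h'
      · exact Or.inr bot_le
      · exact Or.inl le_rfl
      · exact Or.inl (kleinFourPerm_le_alternatingGroup.trans h')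
    · rcases normal_perm_four hM with rfl | rfl | h'
      · exact Or.inr bot_le
      · exact Or.inr (kleinFourPerm_le_alternatingGroup.trans h)
      · exact hA h h'
  · rcases normal_perm hn hn4 hN with rfl | h
    · exact Or.inl bot_le
    · rcases normal_perm hn hn4 hM with rfl | h'
      · exact Or.inr bot_le
      · exact hA h h'

theorem evenNormal_perm_total {n : ℕ} (hn : 3 ≤ n)
    (N M : EvenNormal (Equiv.Perm.sign : Equiv.Perm (Fin n) →* ℤˣ)) : N ≤ M ∨ M ≤ N :=
  normal_perm_total hn ⟨N.1, N.2.1⟩ ⟨M.1, M.2.1⟩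

theorem alternatingGroup_ne_bot {n : ℕ} (hn : 3 ≤ n) : alternatingGroup (Fin n) ≠ ⊥ :=
  (Subgroup.nontrivial_iff_ne_bot _).1
    (alternatingGroup.nontrivial_of_three_le_card (by rwa [Nat.card_fin]))

instance nontrivial_evenNormal_perm {n : ℕ} [hn : Fact (3 ≤ n)] :
    Nontrivial (EvenNormal (Equiv.Perm.sign : Equiv.Perm (Fin n) →* ℤˣ)) :=
  ⟨⊤, ⊥, fun h => alternatingGroup_ne_bot hn.1 (congrArg Subtype.val h)⟩

theorem card_evenNormal_perm {n : ℕ} (hn : 3 ≤ n) :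
    Nat.card (EvenNormal (Equiv.Perm.sign : Equiv.Perm (Fin n) →* ℤˣ)) = if n = 4 then 3 else 2 := by
  have hA := alternatingGroup_ne_bot hn
  change Set.ncard {K : Subgroup (Equiv.Perm (Fin n)) | K.Normal ∧ K ≤ alternatingGroup (Fin n)} = _
  split_ifs with hn4
  · subst hn4
    have hset : {K : Subgroup (Equiv.Perm (Fin 4)) | K.Normal ∧ K ≤ alternatingGroup (Fin 4)} =
        {⊥, kleinFourPerm, alternatingGroup (Fin 4)} := by
      ext K
      simp only [Set.mem_ofPred_eq, Set.mem_insert_iff, Set.mem_singleton_iff]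
      constructor
      · rintro ⟨hK, hKA⟩
        exact (normal_perm_four hK).imp_right fun h => h.imp_right fun h => le_antisymm hKA h
      · rintro (rfl | rfl | rfl)
        · exact ⟨inferInstance, bot_le⟩
        · exact ⟨normal_kleinFourPerm, kleinFourPerm_le_alternatingGroup⟩
        · exact ⟨inferInstance, le_rfl⟩
    have hVA : kleinFourPerm ≠ alternatingGroup (Fin 4) := fun h =>
      alternatingGroup_not_le_kleinFourPerm h.ge
    rw [hset, Set.ncard_eq_three]
    exact ⟨_, _, _, kleinFourPerm_ne_bot.symm, hA.symm, hVA, rfl⟩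
  · have hset : {K : Subgroup (Equiv.Perm (Fin n)) | K.Normal ∧ K ≤ alternatingGroup (Fin n)} =
        {⊥, alternatingGroup (Fin n)} := by
      ext K
      simp only [Set.mem_ofPred_eq, Set.mem_insert_iff, Set.mem_singleton_iff]
      constructor
      · rintro ⟨hK, hKA⟩
        exact (normal_perm hn hn4 hK).imp_right fun h => le_antisymm hKA h
      · rintro (rfl | rfl)
        · exact ⟨inferInstance, bot_le⟩
        · exact ⟨inferInstance, le_rfl⟩
    rw [hset, Set.ncard_pair hA.symm]

/-! ### Functoriality, and groups whose normal subgroups form a chain -/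

/-- Isomorphic groups have isomorphic lattices of normal subgroups. -/
def normalLatticeCongr {G G' : Type*} [Group G] [Group G'] (e : G ≃* G') :
    NormalLattice G ≃o NormalLattice G' where
  toEquiv := e.mapSubgroup.toEquiv.subtypeEquiv fun N => by
    refine ⟨fun h => h.map e.toMonoidHom e.surjective, fun h => ?_⟩
    have h' := h.map e.symm.toMonoidHom e.symm.surjective
    have heq : ((e.mapSubgroup N).map e.symm.toMonoidHom) = N := e.mapSubgroup.symm_apply_apply N
    exact heq ▸ h'
  map_rel_iff' := e.mapSubgroup.le_iff_le

/-- Isomorphic groups have isomorphic groups of lattice automorphisms. -/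
def latAutCongr {G G' : Type*} [Group G] [Group G'] (e : G ≃* G') : LatAut G ≃* LatAut G' :=
  (normalLatticeCongr e).conjMulEquiv

instance {G : Type*} [Group G] : BoundedOrder (NormalLattice G) where
  top := ⟨⊤, inferInstance⟩
  le_top N := (le_top : N.1 ≤ ⊤)
  bot := ⟨⊥, inferInstance⟩
  bot_le N := (bot_le : ⊥ ≤ N.1)

instance {L : Type*} [PartialOrder L] [Finite L] : Finite (L ≃o L) :=
  DFunLike.finite _

/-- The normal subgroups of `G` form a chain. -/
def NormalChain (G : Type*) [Group G] : Prop := ∀ N M : NormalLattice G, N ≤ M ∨ M ≤ N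

theorem NormalChain.of_mulEquiv {G G' : Type*} [Group G] [Group G'] (e : G ≃* G')
    (h : NormalChain G) : NormalChain G' := fun N M => by
  simpa only [OrderIso.le_iff_le] using
    h ((normalLatticeCongr e).symm N) ((normalLatticeCongr e).symm M)

theorem NormalChain.subsingleton_latAut {G : Type*} [Group G] [Finite G] (h : NormalChain G) :
    Subsingleton (LatAut G) := subsingleton_orderIso_of_total h

theorem normalChain_of_card_le_two {G : Type*} [Group G] [Finite G] (h : Nat.card G ≤ 2) :
    NormalChain G := by
  have key (N : Subgroup G) : N = ⊥ ∨ N = ⊤ := by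
    by_contra! hN
    have h1 := (Subgroup.one_lt_card_iff_ne_bot N).2 hN.1
    exact hN.2 (Subgroup.eq_top_of_le_card N (by lia))
  intro N M
  rcases key N.1 with hN | hN
  · exact Or.inl (hN.trans_le bot_le)
  · exact Or.inr ((le_top : M.1 ≤ ⊤).trans_eq hN.symm)

theorem normalChain_perm (n : ℕ) : NormalChain (Equiv.Perm (Fin n)) := by
  by_cases hn : 3 ≤ n
  · exact normal_perm_total hn
  · refine normalChain_of_card_le_two ?_
    rw [Nat.card_perm, Nat.card_fin]
    exact Nat.factorial_le (show n ≤ 2 by lia)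

/-! ### Products of symmetric groups of degree at least three -/

/-- The first step of the tower: the automorphisms permute the factors of degree `4`, whose
chain of even normal subgroups has length three, and the other factors, whose chain has length
two. -/
theorem nonempty_latAut_pi_perm_mulEquiv {ι : Type*} [Finite ι] (k : ι → ℕ) (hk : ∀ i, 3 ≤ k i) :
    Nonempty (LatAut (∀ i, Equiv.Perm (Fin (k i))) ≃*
      Equiv.Perm {i // k i = 4} × Equiv.Perm {i // ¬ k i = 4}) := by
  have (i : ι) : Fact (3 ≤ k i) := ⟨hk i⟩
  obtain ⟨e⟩ := SignData.nonempty_mulEquiv_perm_prod_perm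
    (fun i => evenNormal_perm_total (hk i)) (fun i => k i = 4) fun i j => by
      rw [card_evenNormal_perm (hk i), card_evenNormal_perm (hk j)]
      by_cases hi : k i = 4 <;> by_cases hj : k j = 4 <;> simp [hi, hj]
  exact ⟨(normalLatticeOrderIso _ fun i => isSignGroup_perm (hk i)).conjMulEquiv.trans e⟩

/-- A product of two symmetric groups is a product over a family of two indices. -/
def permProdPermMulEquiv (a b : ℕ) :
    (∀ i : Fin 2, Equiv.Perm (Fin (![a, b] i))) ≃* Equiv.Perm (Fin a) × Equiv.Perm (Fin b) :=
  { piFinTwoEquiv fun i => Equiv.Perm (Fin (![a, b] i)) with map_mul' := fun _ _ => rfl }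

theorem card_latAut_perm_prod_perm_le_two {a b : ℕ} (ha : 3 ≤ a) (hb : 3 ≤ b) :
    Nat.card (LatAut (Equiv.Perm (Fin a) × Equiv.Perm (Fin b))) ≤ 2 := by
  obtain ⟨e⟩ := nonempty_latAut_pi_perm_mulEquiv ![a, b] (Fin.forall_fin_two.2 ⟨ha, hb⟩)
  rw [Nat.card_congr ((latAutCongr (permProdPermMulEquiv a b)).symm.trans e).toEquiv]
  refine (Nat.card_le_card_of_injective _
    (Equiv.Perm.subtypeCongrHom_injective fun i => ![a, b] i = 4)).trans ?_
  rw [Nat.card_perm, Nat.card_fin]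
  rfl

/-! ### The product of a symmetric group with a group of order two -/

section ProdOrderTwo

variable {H T : Type*} [Group H] [Group T] {s : H →* ℤˣ}

open scoped commutatorElement in
/-- A normal subgroup of `H × T` contains the even part of its projection to `H`, because it
contains the commutators of its elements with `H`. -/
theorem mk_one_mem_of_mem (hs : IsSignGroup s) {N : Subgroup (H × T)} (hN : N.Normal)
    {h : H} {x : T} (hx : (h, x) ∈ N) (hh : h ∈ s.ker) : (h, (1 : T)) ∈ N := by
  have hN' := hN.map (MonoidHom.fst H T) Prod.fst_surjective
  suffices hle : ⁅N.map (MonoidHom.fst H T), ⊤⁆ ≤ N.comap (MonoidHom.inl H T) from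
    hle (hs.inf_le_commutator _ hN' ⟨⟨_, hx, rfl⟩, hh⟩)
  rw [Subgroup.commutator_le]
  rintro _ ⟨n, hn, rfl⟩ k -
  have heq : MonoidHom.inl H T ⁅MonoidHom.fst H T n, k⁆ = ⁅n, (k, (1 : T))⁆ := by
    ext <;> simp [commutatorElement_def]
  rw [Subgroup.mem_comap, heq, commutatorElement_def, mul_assoc, mul_assoc, ← mul_assoc _ n⁻¹]
  exact mul_mem hn (hN.conj_mem _ (inv_mem hn) _)

theorem one_mk_mem_of_mem (hs : IsSignGroup s) {N : Subgroup (H × T)} (hN : N.Normal)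
    {h : H} {x : T} (hx : (h, x) ∈ N) (hh : h ∈ s.ker) : ((1 : H), x) ∈ N := by
  simpa using mul_mem (inv_mem (mk_one_mem_of_mem hs hN hx hh)) hx

variable (H T) in
/-- The second factor of `H × T`, as a normal subgroup. -/
def sndFactor : NormalLattice (H × T) := ⟨(⊥ : Subgroup H).prod ⊤, inferInstance⟩

/-- The normal subgroup of the elements of `H × T` whose first coordinate has sign `1`. -/
def evenFst (T : Type*) [Group T] (s : H →* ℤˣ) : NormalLattice (H × T) :=
  ⟨s.ker.prod ⊤, inferInstance⟩

/-- The normal subgroups of `H × T` that neither contain the second factor nor consist of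
elements with even first coordinate: for `T` of order two, the graphs of the two homomorphisms
from `H` to `T` that factor through the sign. -/
def graphNormals (T : Type*) [Group T] (s : H →* ℤˣ) : Set (NormalLattice (H × T)) :=
  {N | ¬ sndFactor H T ≤ N ∧ ¬ N ≤ evenFst T s}

variable (hT : Nat.card T = 2)
include hT

theorem sndFactor_le_iff {N : NormalLattice (H × T)} {x : T} (hx : x ≠ 1) :
    sndFactor H T ≤ N ↔ ((1 : H), x) ∈ N.1 := by
  refine ⟨fun h => h ⟨rfl, trivial⟩, fun h => ?_⟩
  rintro ⟨h', y⟩ ⟨hh, -⟩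
  obtain rfl : h' = 1 := hh
  by_cases hy : y = 1
  · subst hy; exact one_mem _
  · obtain ⟨u, v, -, huv⟩ := Nat.card_eq_two_iff.1 hT
    have hxy : x = y := by
      have hmem (z : T) : z = u ∨ z = v := by simpa using huv.ge (Set.mem_univ z)
      have h1 := hmem 1
      have h2 := hmem x
      have h3 := hmem y
      grind
    exact hxy ▸ h

theorem eq_one_of_not_sndFactor_le (hs : IsSignGroup s) {N : NormalLattice (H × T)}
    (hZ : ¬ sndFactor H T ≤ N) {h : H} {x : T} (hx : (h, x) ∈ N.1) (hh : h ∈ s.ker) : x = 1 := by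
  by_contra hx1
  exact hZ ((sndFactor_le_iff hT hx1).2 (one_mk_mem_of_mem hs N.2 hx hh))

theorem isAtom_sndFactor : IsAtom (sndFactor H T) := by
  have : Finite T := Nat.finite_of_card_ne_zero (by lia)
  have : Nontrivial T := Finite.one_lt_card_iff_nontrivial.1 (by lia)
  constructor
  · intro h
    obtain ⟨x, hx⟩ := exists_ne (1 : T)
    have hmem := (sndFactor_le_iff hT hx).1 h.le
    exact hx (congrArg Prod.snd (Subgroup.mem_bot.1 hmem))
  · intro N hN
    refine Subtype.ext ((Subgroup.eq_bot_iff_forall _).2 fun n hn => ?_)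
    obtain ⟨h, x⟩ := n
    obtain rfl : h = 1 := (hN.le hn).1
    by_contra hx
    exact hN.not_ge ((sndFactor_le_iff hT fun h => hx (by rw [h]; rfl)).2 hn)

omit hT in
theorem le_total_of_sndFactor_le (hH : NormalChain H) {N M : NormalLattice (H × T)}
    (hN : sndFactor H T ≤ N) (hM : sndFactor H T ≤ M) : N ≤ M ∨ M ≤ N := by
  have key {N M : NormalLattice (H × T)} (hM : sndFactor H T ≤ M)
      (h : N.1.map (MonoidHom.fst H T) ≤ M.1.map (MonoidHom.fst H T)) : N ≤ M := by
    rintro ⟨h', x⟩ hx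
    obtain ⟨⟨_, y⟩, hy, rfl⟩ := h ⟨_, hx, rfl⟩
    have h1 : ((1 : H), y⁻¹ * x) ∈ M.1 := hM ⟨rfl, trivial⟩
    simpa using mul_mem hy h1
  exact (hH ⟨_, N.2.map (MonoidHom.fst H T) Prod.fst_surjective⟩
    ⟨_, M.2.map (MonoidHom.fst H T) Prod.fst_surjective⟩).imp (key hM) (key hN)

theorem le_total_of_le_evenFst (hs : IsSignGroup s) (hH : NormalChain H)
    {N M : NormalLattice (H × T)} (hN : ¬ sndFactor H T ≤ N) (hM : ¬ sndFactor H T ≤ M)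
    (hNA : N ≤ evenFst T s) (hMA : M ≤ evenFst T s) : N ≤ M ∨ M ≤ N := by
  have key {N M : NormalLattice (H × T)} (hN : ¬ sndFactor H T ≤ N) (hNA : N ≤ evenFst T s)
      (h : N.1.map (MonoidHom.fst H T) ≤ M.1.map (MonoidHom.fst H T)) : N ≤ M := by
    rintro ⟨h', x⟩ hx
    have hker : h' ∈ s.ker := (hNA hx).1
    obtain rfl := eq_one_of_not_sndFactor_le hT hs hN hx hker
    obtain ⟨⟨_, y⟩, hy, rfl⟩ := h ⟨_, hx, rfl⟩
    exact mk_one_mem_of_mem hs M.2 hy hker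
  exact (hH ⟨_, N.2.map (MonoidHom.fst H T) Prod.fst_surjective⟩
    ⟨_, M.2.map (MonoidHom.fst H T) Prod.fst_surjective⟩).imp (key hN hNA) (key hM hMA)

omit hT in
theorem map_fst_eq_top (hs : IsSignGroup s) {N : NormalLattice (H × T)}
    (hN : N ∈ graphNormals T s) : N.1.map (MonoidHom.fst H T) = ⊤ :=
  (hs.eq_top_or_le _ (N.2.map (MonoidHom.fst H T) Prod.fst_surjective)).resolve_right fun h =>
    hN.2 fun n hn => ⟨h ⟨n, hn, rfl⟩, trivial⟩

omit hT in
theorem exists_mem_of_mem_graphNormals (hs : IsSignGroup s) {N : NormalLattice (H × T)}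
    (hN : N ∈ graphNormals T s) (h : H) : ∃ x, (h, x) ∈ N.1 := by
  obtain ⟨⟨_, x⟩, hx, rfl⟩ := (map_fst_eq_top hs hN).ge (Subgroup.mem_top h)
  exact ⟨x, hx⟩

/-- A member of `graphNormals T s` is determined by its value at one odd element `h₀`. -/
theorem le_of_mem_graphNormals (hs : IsSignGroup s) {N M : NormalLattice (H × T)}
    (hN : N ∈ graphNormals T s) (hM : M ∈ graphNormals T s) {h₀ : H} (h0 : s h₀ = -1) {x₀ : T}
    (hx0 : (h₀, x₀) ∈ N.1) (hy0 : (h₀, x₀) ∈ M.1) : N ≤ M := by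
  have key {h : H} {x : T} (hx : (h, x) ∈ N.1) (hh : h ∈ s.ker) : (h, x) ∈ M.1 := by
    obtain rfl := eq_one_of_not_sndFactor_le hT hs hN.1 hx hh
    obtain ⟨y, hy⟩ := exists_mem_of_mem_graphNormals hs hM h
    exact mk_one_mem_of_mem hs M.2 hy hh
  rintro ⟨h, x⟩ hx
  by_cases hh : s h = 1
  · exact key hx hh
  · have h1 := (Int.units_eq_one_or _).resolve_left hh
    have h2 := key (h := h * h₀⁻¹) (x := x * x₀⁻¹) (mul_mem hx (inv_mem hx0))
      (by simp [MonoidHom.mem_ker, h0, h1])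
    simpa using mul_mem h2 hy0

theorem card_graphNormals_le_two (hs : IsSignGroup s) : Nat.card (graphNormals T s) ≤ 2 := by
  have : Finite T := Nat.finite_of_card_ne_zero (by lia)
  obtain ⟨h₀, h0⟩ := hs.surjective (-1)
  choose f hf using fun N : graphNormals T s => exists_mem_of_mem_graphNormals hs N.2 h₀
  rw [← hT]
  refine Nat.card_le_card_of_injective f fun N M hNM => Subtype.ext ?_
  have hN := hf N
  rw [hNM] at hN
  exact le_antisymm (le_of_mem_graphNormals hT hs N.2 M.2 h0 hN (hf M))
    (le_of_mem_graphNormals hT hs M.2 N.2 h0 (hf M) hN)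

/-- The second factor is the only atom above which the normal subgroups form a chain: any other
atom is contained in the first factor and in `evenFst T s`, which are not comparable. -/
theorem apply_sndFactor (hs : IsSignGroup s) (hH : NormalChain H) (hker : s.ker ≠ ⊥)
    (φ : LatAut (H × T)) : φ (sndFactor H T) = sndFactor H T := by
  have : Finite T := Nat.finite_of_card_ne_zero (by lia)
  have : Nontrivial T := Finite.one_lt_card_iff_nontrivial.1 (by lia)
  have hatom : IsAtom (φ (sndFactor H T)) := (φ.isAtom_iff _).2 (isAtom_sndFactor hT)
  have hchain {N M} (hN : φ (sndFactor H T) ≤ N) (hM : φ (sndFactor H T) ≤ M) :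
      N ≤ M ∨ M ≤ N := by
    rw [← φ.le_symm_apply] at hN hM
    simpa using le_total_of_sndFactor_le hH hN hM
  by_cases hZ : sndFactor H T ≤ φ (sndFactor H T)
  · exact ((hatom.le_iff.1 hZ).resolve_left (isAtom_sndFactor hT).1).symm
  · exfalso
    have hE : φ (sndFactor H T) ≤ evenFst T s := by
      by_contra hE
      let A : NormalLattice (H × T) := ⟨s.ker.prod ⊥, inferInstance⟩
      have hle : A ≤ φ (sndFactor H T) := by
        rintro ⟨h, x⟩ ⟨hh, hx⟩
        obtain rfl : x = 1 := hx
        obtain ⟨y, hy⟩ := exists_mem_of_mem_graphNormals hs ⟨hZ, hE⟩ h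
        exact mk_one_mem_of_mem hs (φ (sndFactor H T)).2 hy hh
      rcases hatom.le_iff.1 hle with h | h
      · refine hker ((Subgroup.eq_bot_iff_forall _).2 fun k hk => ?_)
        have : (k, (1 : T)) ∈ A.1 := ⟨hk, rfl⟩
        rw [h] at this
        exact congrArg Prod.fst (Subgroup.mem_bot.1 this)
      · exact hE (h ▸ fun n hn => ⟨hn.1, trivial⟩)
    let F : NormalLattice (H × T) := ⟨(⊤ : Subgroup H).prod ⊥, inferInstance⟩
    have hF : φ (sndFactor H T) ≤ F := fun n hn =>
      ⟨trivial, eq_one_of_not_sndFactor_le hT hs hZ hn (hE hn).1⟩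
    rcases hchain hE hF with h | h
    · obtain ⟨x, hx⟩ := exists_ne (1 : T)
      exact hx (h (show ((1 : H), x) ∈ (evenFst T s).1 from ⟨one_mem _, trivial⟩)).2
    · obtain ⟨h₀, h0⟩ := hs.surjective (-1)
      have h1 : s h₀ = 1 := (h (show (h₀, (1 : T)) ∈ F.1 from ⟨trivial, rfl⟩)).1
      rw [h0] at h1
      exact absurd h1 (by decide)

/-- A lattice automorphism of `H × T` fixes every normal subgroup outside `graphNormals T s`, which
has at most two members. -/
theorem card_latAut_prod_le_two [Finite H] (hs : IsSignGroup s) (hH : NormalChain H)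
    (hker : s.ker ≠ ⊥) : Nat.card (LatAut (H × T)) ≤ 2 := by
  have : Finite T := Nat.finite_of_card_ne_zero (by lia)
  have hZ (φ : LatAut (H × T)) (N) : sndFactor H T ≤ N ↔ sndFactor H T ≤ φ N := by
    conv_rhs => rw [← apply_sndFactor hT hs hH hker φ, φ.le_iff_le]
  have hfixZ (φ : LatAut (H × T)) {N} (hN : sndFactor H T ≤ N) : φ N = N :=
    φ.apply_eq_self_of_mem_chain {N | sndFactor H T ≤ N}
      (fun N hN M hM => le_total_of_sndFactor_le hH hN hM) (hZ φ) hN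
  have hE (φ : LatAut (H × T)) (N) : N ≤ evenFst T s ↔ φ N ≤ evenFst T s := by
    have h : φ (evenFst T s) = evenFst T s :=
      hfixZ φ fun n hn => ⟨hn.1.symm ▸ one_mem _, trivial⟩
    conv_rhs => rw [← h, φ.le_iff_le]
  have hfixE (φ : LatAut (H × T)) {N} (hN : ¬ sndFactor H T ≤ N) (hNE : N ≤ evenFst T s) :
      φ N = N :=
    φ.apply_eq_self_of_mem_chain {N | ¬ sndFactor H T ≤ N ∧ N ≤ evenFst T s}
      (fun N hN M hM => le_total_of_le_evenFst hT hs hH hN.1 hM.1 hN.2 hM.2)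
      (fun N => and_congr (not_congr (hZ φ N)) (hE φ N)) ⟨hN, hNE⟩
  let ρ : LatAut (H × T) → Equiv.Perm (graphNormals T s) := fun φ =>
    φ.toEquiv.subtypeEquiv fun N => and_congr (not_congr (hZ φ N)) (not_congr (hE φ N))
  have hρ : Function.Injective ρ := by
    intro φ ψ h
    refine OrderIso.ext (funext fun N => ?_)
    by_cases h1 : sndFactor H T ≤ N
    · rw [hfixZ φ h1, hfixZ ψ h1]
    by_cases h2 : N ≤ evenFst T s
    · rw [hfixE φ h1 h2, hfixE ψ h1 h2]
    exact congrArg Subtype.val (Equiv.congr_fun h ⟨N, h1, h2⟩)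
  refine (Nat.card_le_card_of_injective ρ hρ).trans ?_
  rw [Nat.card_perm]
  exact Nat.factorial_le (card_graphNormals_le_two hT hs)

end ProdOrderTwo

/-! ### The Klein four-group -/

/-- The normal subgroups of a Klein four-group other than the trivial ones are the three subgroups of
order two, and the automorphisms of the lattice permute these arbitrarily. -/
theorem nonempty_latAut_mulEquiv_perm_three {G : Type*} [CommGroup G] (hcard : Nat.card G = 4)
    (hsq : ∀ g : G, g ^ 2 = 1) : Nonempty (LatAut G ≃* Equiv.Perm (Fin 3)) := by
  have : Finite G := Nat.finite_of_card_ne_zero (by lia)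
  have hz {g : G} (hg : g ≠ 1) : Nat.card (Subgroup.zpowers g) = 2 := by
    rw [Nat.card_zpowers]
    exact orderOf_eq_prime (hsq g) hg
  have hatom {N : NormalLattice G} (hN : Nat.card N.1 = 2) : IsAtom N := by
    refine ⟨fun h => ?_, fun M hM => ?_⟩
    · rw [h] at hN
      have : Nat.card (⊥ : Subgroup G) = 2 := hN
      simp at this
    · by_contra hbot
      have h1 := (Subgroup.one_lt_card_iff_ne_bot M.1).2 fun h => hbot (Subtype.ext h)
      exact hM.ne (Subtype.ext (Subgroup.eq_of_le_of_card_ge hM.le (by lia)))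
  have h3 (N : NormalLattice G) : N = ⊥ ∨ N = ⊤ ∨ IsAtom N := by
    have hdvd : Nat.card N.1 ∣ 2 ^ 2 := by
      have := Subgroup.card_subgroup_dvd_card N.1
      rwa [hcard] at this
    obtain ⟨m, hm, hNm⟩ := (Nat.dvd_prime_pow Nat.prime_two).1 hdvd
    interval_cases m
    · exact Or.inl (Subtype.ext (Subgroup.eq_bot_of_card_eq N.1 hNm))
    · exact Or.inr (Or.inr (hatom hNm))
    · exact Or.inr (Or.inl (Subtype.ext (Subgroup.eq_top_of_card_eq N.1 (hNm.trans hcard.symm))))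
  let f : {g : G // g ≠ 1} → {N : NormalLattice G // IsAtom N} := fun g =>
    ⟨⟨Subgroup.zpowers g.1, inferInstance⟩, hatom (hz g.2)⟩
  have hf : Function.Bijective f := by
    constructor
    · intro g h hgh
      have heq : Subgroup.zpowers g.1 = Subgroup.zpowers h.1 := congrArg (fun N => N.1.1) hgh
      obtain ⟨n, hn⟩ := heq.ge (Subgroup.mem_zpowers h.1)
      have hg2 : g.1 ^ (2 : ℤ) = 1 := by exact_mod_cast hsq g.1
      rcases Int.even_or_odd' n with ⟨k, rfl | rfl⟩
      · simp only [zpow_mul, hg2, one_zpow] at hn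
        exact absurd hn.symm h.2
      · simp only [zpow_add, zpow_mul, hg2, one_zpow, zpow_one, one_mul] at hn
        exact Subtype.ext hn
    · rintro ⟨N, hN⟩
      obtain ⟨g, hg, hg1⟩ := (Subgroup.bot_or_exists_ne_one N.1).resolve_left fun h =>
        hN.1 (Subtype.ext h)
      refine ⟨⟨g, hg1⟩, Subtype.ext ?_⟩
      exact (hN.le_iff.1 (Subgroup.zpowers_le.2 hg)).resolve_left (f ⟨g, hg1⟩).2.1
  have hcard3 : Nat.card {N : NormalLattice G // IsAtom N} = Nat.card (Fin 3) := by
    classical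
    have := Fintype.ofFinite G
    rw [← Nat.card_congr (Equiv.ofBijective f hf), Nat.card_eq_fintype_card,
      Fintype.card_subtype_compl, Fintype.card_subtype_eq, ← Nat.card_eq_fintype_card, hcard,
      Nat.card_fin]
  have htop : ¬ IsAtom (⊤ : NormalLattice G) := by
    intro htop
    have : Nontrivial G := Finite.one_lt_card_iff_nontrivial.1 (by lia)
    obtain ⟨g, hg⟩ := exists_ne (1 : G)
    have h1 := (htop.le_iff.1 (le_top : (f ⟨g, hg⟩).1 ≤ ⊤)).resolve_left (f ⟨g, hg⟩).2.1
    have h2 := hz hg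
    have h3 : Nat.card (Subgroup.zpowers g) = Nat.card (⊤ : Subgroup G) :=
      congrArg (fun N : NormalLattice G => Nat.card N.1) h1
    rw [Subgroup.card_top] at h3
    lia
  obtain ⟨e⟩ := (Finite.card_eq).1 hcard3
  exact ⟨(MulEquiv.ofBijective _ (OrderIso.atomPerm_bijective htop h3)).trans e.permCongrHom⟩

theorem nonempty_latAut_cyclicTwo_prod :
    Nonempty (LatAut (CyclicTwo × CyclicTwo) ≃* Equiv.Perm (Fin 3)) :=
  nonempty_latAut_mulEquiv_perm_three (by simp [CyclicTwo]) (by decide)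

theorem nonempty_perm_two_mulEquiv {α : Type*} (h : Nat.card α = 2) :
    Nonempty (Equiv.Perm α ≃* CyclicTwo) := by
  have : Finite α := Nat.finite_of_card_ne_zero (by lia)
  have : Fact (Nat.Prime 2) := ⟨Nat.prime_two⟩
  exact ⟨mulEquivOfPrimeCardEq (p := 2) (by rw [Nat.card_perm, h]; rfl) (by simp [CyclicTwo])⟩

/-! ### The tower -/

/-- The second step of the tower: `Aut(𝒩(S_a × S_b))` has order at most two, or it is `S_3` for
`a = b = 2`. -/
theorem normalChain_latAut_perm_prod_perm (a b : ℕ) :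
    NormalChain (LatAut (Equiv.Perm (Fin a) × Equiv.Perm (Fin b))) := by
  wlog hab : a ≤ b generalizing a b
  · exact (this b a (by lia)).of_mulEquiv (latAutCongr MulEquiv.prodComm)
  by_cases ha : a ≤ 1
  · have : Subsingleton (Fin a) := Fin.subsingleton_iff_le_one.2 ha
    have hchain := (normalChain_perm b).of_mulEquiv
      (MulEquiv.uniqueProd (N := Equiv.Perm (Fin a)) (M := Equiv.Perm (Fin b))).symm
    have := hchain.subsingleton_latAut
    exact normalChain_of_card_le_two ((Finite.card_le_one_iff_subsingleton.2 this).trans one_le_two)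
  by_cases hb : b = 2
  · obtain rfl : a = 2 := by lia
    subst hb
    obtain ⟨e⟩ := nonempty_perm_two_mulEquiv (Nat.card_fin 2)
    obtain ⟨e'⟩ := nonempty_latAut_cyclicTwo_prod
    exact (normalChain_perm 3).of_mulEquiv ((latAutCongr (e.prodCongr e)).trans e').symm
  refine normalChain_of_card_le_two ?_
  by_cases ha2 : a = 2
  · subst ha2
    have hb : 3 ≤ b := by lia
    rw [Nat.card_congr (latAutCongr MulEquiv.prodComm).toEquiv]
    exact card_latAut_prod_le_two (by rw [Nat.card_perm, Nat.card_fin]; rfl) (isSignGroup_perm hb)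
      (normalChain_perm b) (by
        rw [← alternatingGroup_eq_sign_ker]
        exact alternatingGroup_ne_bot hb)
  · exact card_latAut_perm_prod_perm_le_two (by lia) (by lia)

theorem subsingleton_latAut_latAut_latAut {G : Type*} [Group G] {α β : Type*} [Finite α] [Finite β]
    (e : LatAut G ≃* Equiv.Perm α × Equiv.Perm β) : Subsingleton (LatAut (LatAut (LatAut G))) := by
  have e' : LatAut G ≃* Equiv.Perm (Fin (Nat.card α)) × Equiv.Perm (Fin (Nat.card β)) :=
    e.trans ((Finite.equivFin α).permCongrHom.prodCongr (Finite.equivFin β).permCongrHom)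
  have : Finite (LatAut G) := Finite.of_equiv _ e.symm.toEquiv
  exact ((normalChain_latAut_perm_prod_perm _ _).of_mulEquiv
    (latAutCongr e').symm).subsingleton_latAut

theorem IsTowerGroup.subsingleton {G : Type*} [Group G] (h : IsTowerGroup G) :
    Subsingleton (LatAut (LatAut (LatAut G))) := by
  obtain ⟨a, ⟨e⟩⟩ := h
  -- The factors are indexed by the finite type of pairs of a degree and an index for it.
  have : Finite (Σ k, Fin (a k)) := by
    refine Finite.of_injective (β := Σ k : a.support, Fin (a k))
      (fun x => ⟨⟨x.1, Finsupp.mem_support_iff.2 fun h => (h ▸ x.2).elim0⟩, x.2⟩) ?_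
    rintro ⟨k, x⟩ ⟨l, y⟩ h
    simpa using h
  let e' : (∀ i : Σ k, Fin (a k), Equiv.Perm (Fin i.1)) ≃*
      (∀ k, Fin (a k) → Equiv.Perm (Fin (k : ℕ))) :=
    { Equiv.piCurry fun (k : {k : ℕ // 3 ≤ k}) (_ : Fin (a k)) => Equiv.Perm (Fin (k : ℕ)) with
      map_mul' := fun _ _ => rfl }
  obtain ⟨e''⟩ := nonempty_latAut_pi_perm_mulEquiv (fun i : Σ k, Fin (a k) => (i.1 : ℕ))
    fun i => i.1.2
  exact subsingleton_latAut_latAut_latAut ((latAutCongr (e.trans e'.symm)).trans e'')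

theorem nonempty_latAut_sharpExample :
    Nonempty (LatAut SharpExample ≃* CyclicTwo × CyclicTwo) := by
  let k : Fin 2 ⊕ Fin 2 → ℕ := Sum.elim (fun _ => 4) fun _ => 3
  let e : SharpExample ≃* ∀ i, Equiv.Perm (Fin (k i)) :=
    { toFun := fun f i => match i with
        | Sum.inl i => f.1 i
        | Sum.inr i => f.2 i
      invFun := fun f => (fun i => f (Sum.inl i), fun i => f (Sum.inr i))
      left_inv := fun _ => rfl
      right_inv := fun f => by ext (i | i) <;> rfl
      map_mul' := fun f g => by ext (i | i) <;> rfl }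
  have h4 : Nat.card {i // k i = 4} = 2 := by
    rw [Nat.card_eq_fintype_card]; decide
  have h3 : Nat.card {i // ¬ k i = 4} = 2 := by
    rw [Nat.card_eq_fintype_card]; decide
  obtain ⟨e₁⟩ := nonempty_latAut_pi_perm_mulEquiv k (by decide)
  obtain ⟨e₂⟩ := nonempty_perm_two_mulEquiv h4
  obtain ⟨e₃⟩ := nonempty_perm_two_mulEquiv h3
  exact ⟨(latAutCongr e).trans (e₁.trans (e₂.prodCongr e₃))⟩

theorem isTowerGroup_sharpExample : IsTowerGroup SharpExample := by
  let a : {k : ℕ // 3 ≤ k} →₀ ℕ := Finsupp.onFinset {⟨3, le_rfl⟩, ⟨4, Nat.le_succ 3⟩}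
    (fun k => if k.1 = 3 ∨ k.1 = 4 then 2 else 0) (by
      rintro ⟨k, hk⟩ h
      simp only [ne_eq, ite_eq_right_iff, Classical.not_imp] at h
      simpa using h.1)
  have ha3 (h) : a ⟨3, h⟩ = 2 := rfl
  have ha4 (h) : a ⟨4, h⟩ = 2 := rfl
  have ha5 (k h) : a ⟨k + 5, h⟩ = 0 := by
    simp [a]
  refine ⟨a, ⟨?_⟩⟩
  exact
    { toFun := fun f k => match k with
        | ⟨3, h⟩ => fun i => f.2 (Fin.cast (ha3 h) i)
        | ⟨4, h⟩ => fun i => f.1 (Fin.cast (ha4 h) i)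
        | ⟨_ + 5, _⟩ => 1
      invFun := fun f => (fun i => f ⟨4, Nat.le_succ 3⟩ i, fun i => f ⟨3, le_rfl⟩ i)
      left_inv := fun _ => rfl
      right_inv := fun f => by
        funext k i
        match k, i with
        | ⟨3, h⟩, i => rfl
        | ⟨4, h⟩, i => rfl
        | ⟨k + 5, h⟩, i => exact (ha5 k h ▸ i).elim0
      map_mul' := fun f g => by
        funext k i
        match k, i with
        | ⟨3, h⟩, i => rfl
        | ⟨4, h⟩, i => rfl
        | ⟨k + 5, h⟩, i => rfl }

theorem theorem2 :
    (∀ (G : Type*) [Group G], IsTowerGroup G → Subsingleton (latAutTower G 3)) ∧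
    (IsTowerGroup SharpExample ∧
      Nonempty (latAutTower SharpExample 1 ≃* (CyclicTwo × CyclicTwo)) ∧
      Nonempty (latAutTower SharpExample 2 ≃* Equiv.Perm (Fin 3)) ∧
      Nontrivial (latAutTower SharpExample 2) ∧
      Subsingleton (latAutTower SharpExample 3)) := by
  obtain ⟨e₁⟩ := nonempty_latAut_sharpExample
  obtain ⟨e₂⟩ := nonempty_latAut_cyclicTwo_prod
  have e : LatAut (LatAut SharpExample) ≃* Equiv.Perm (Fin 3) := (latAutCongr e₁).trans e₂
  exact ⟨fun G _ h => h.subsingleton, isTowerGroup_sharpExample, ⟨e₁⟩, ⟨e⟩,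
    e.toEquiv.nontrivial, isTowerGroup_sharpExample.subsingleton⟩
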